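/- Theorem 1 (Existence of Nash Equilibrium). Let $\mathcal V$ be a finite vocabulary and $\ell$ a maximal length. Let $\mathcal A_G$ be the finite set of all token sequences over $\mathcal V$ of length $1$ to $\ell$ and let $\mathcal A_R=\{0,1\}$ ($1$ = "correct", $0$ = "incorrect"). Let $y:\mathcal A_G\to\{0,1\}$ be the ground-truth labelling and let $p$ be any probability distribution over the finite token sequences $s$ given to the Generator. Define the rewards by $r_R(y,y')=1$ if $y=y'$ and $-1$ otherwise, and $r_G(0,1)=1$, $r_G(0,0)=0$, $r_G(1,y')=-1$. For a Generator policy $\pi$ and a Reward Model (PRM) policy $\rho$ put, for $i\in\{G,R\}$, $$U_i(\pi,\rho)=\mathbb E_{s\sim p,\ a\sim\pi(\cdot|s),\ y'\sim\rho(\cdot|a)}\,[\,r_i(y(a),y')\,].$$ Let $\tau,c_H>0$, and let $\pi_0,\rho_0$ be reference policies of the two players. Let $\mathrm{KL}(\mu\|\nu)=\sum_x\mu(x)\log\frac{\mu(x)}{\nu(x)}$ (equal to $+\infty$ if $\mu$ charges a point that $\nu$ does not) and $H(\mu)=-\sum_x\mu(x)\log\mu(x)$, and consider the general-sum game with regularized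 utilities $$U_G'(\pi,\rho)=U_G(\pi,\rho)-\tau\,\mathrm{KL}(\pi\|\pi_0)+c_H H(\pi),\qquad U_R'(\pi,\rho)=U_R(\pi,\rho)-\tau\,\mathrm{KL}(\rho\|\rho_0)+c_H H(\rho).$$ Then this game has at least one Nash equilibrium in mixed strategies: there is $(\pi^*,\rho^*)$ with $U_G'(\pi,\rho^*)\le U_G'(\pi^*,\rho^*)$ for every strategy $\pi$ of the Generator and $U_R'(\pi^*,\rho)\le U_R'(\pi^*,\rho^*)$ for every strategy $\rho$ of the Reward Model. This holds under each of the following two readings of "strategy": (a) strategies and reference policies are elements $\pi,\pi_0\in\Delta(\mathcal A_G)$ and $\rho,\rho_0\in\Delta(\mathcal A_R)$, so that $\pi(\cdot|s)=\pi$ and $\rho(\cdot|a)=\rho$; (b) strategies and reference policies are conditional, $s\mapsto\pi(\cdot|s)\in\Delta(\mathcal A_G)$ and $a\mapsto\rho(\cdot|a)\in\Delta(\mathcal A_R)$, where in $U_G'$ the terms KL and $H$ are averaged over $s\sim p$, and in $U_R'$ they are averaged over $s\sim p$, $a\sim\pi(\cdot|s)$. -/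

import Mathlib

noncomputable section

namespace AdversarialPRM

/-- Probability distributions over a finite set `A` of actions: the simplex `Δ(A)`. -/
abbrev Policy (A : Type*) [Fintype A] : Type _ := ↥(stdSimplex ℝ A)

/-- The generator's actions: all sequences of tokens from `V` whose length is one of `1, …, ℓ`. -/
abbrev GenAction (V : Type*) (ℓ : ℕ) := (n : Fin ℓ) × (Fin (n + 1) → V)

/-- Labels, and actions of the reward model: `1` is "correct" and `0` is "incorrect". -/
abbrev Label := Fin 2

/-- Reward of the reward model, from the true label `y` and the predicted label `y'`. -/
def rewardR (y y' : Label) : ℝ := if y = y' then 1 else -1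

/-- Reward of the generator, from the true label `y` and the predicted label `y'`. -/
def rewardG (y y' : Label) : ℝ :=
  if y = 0 ∧ y' = 1 then 1 else if y = 0 ∧ y' = 0 then 0 else -1

section Information

variable {A : Type*} [Fintype A]

/-- Shannon entropy `-∑ a, π a * log (π a)`. -/
def entropy (π : Policy A) : ℝ := -∑ a, π.1 a * Real.log (π.1 a)

/-- The sum that defines the Kullback-Leibler divergence is nonnegative, so `ENNReal.ofReal` in
`kl` below never truncates. -/
theorem kl_sum_nonneg (π π₀ : Policy A) (h : ∀ a, π₀.1 a = 0 → π.1 a = 0) :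
    0 ≤ ∑ a, π.1 a * Real.log (π.1 a / π₀.1 a) := by
  have key : ∀ a, π.1 a - π₀.1 a ≤ π.1 a * Real.log (π.1 a / π₀.1 a) := by
    intro a
    rcases (π.2.1 a).eq_or_lt with h0 | h0
    · rw [← h0]
      simpa using π₀.2.1 a
    · have h1 : 0 < π₀.1 a :=
        lt_of_le_of_ne (π₀.2.1 a) fun e => h0.ne' (h a e.symm)
      have h2 := Real.one_sub_inv_le_log_of_pos (div_pos h0 h1)
      have h3 := mul_le_mul_of_nonneg_left h2 h0.le
      have h4 : π.1 a * (1 - (π.1 a / π₀.1 a)⁻¹) = π.1 a - π₀.1 a := by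
        field_simp
      linarith
  calc (0 : ℝ) = ∑ a, (π.1 a - π₀.1 a) := by
        rw [Finset.sum_sub_distrib, π.2.2, π₀.2.2, sub_self]
    _ ≤ _ := Finset.sum_le_sum fun a _ => key a

open Classical in
/-- Kullback-Leibler divergence `KL(π ‖ π₀)`: infinite unless `π` vanishes wherever `π₀` does. -/
def kl (π π₀ : Policy A) : ENNReal :=
  if ∀ a, π₀.1 a = 0 → π.1 a = 0 then
    ENNReal.ofReal (∑ a, π.1 a * Real.log (π.1 a / π₀.1 a))
  else ⊤

end Information

/-- `(x, y)` is a Nash equilibrium of the two-player game with strategy sets `X`, `Y` and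
utilities `u₁`, `u₂`: no player gains by deviating alone. -/
def IsNash {X Y : Type*} (u₁ u₂ : X → Y → EReal) (x : X) (y : Y) : Prop :=
  (∀ x' : X, u₁ x' y ≤ u₁ x y) ∧ (∀ y' : Y, u₂ x y' ≤ u₂ x y)

section Game

variable {V : Type*} [Fintype V] {ℓ : ℕ}

/-- Expected reward `E[r (y a) y']` over `s ∼ p`, `a ∼ π(· | s)`, `y' ∼ ρ(· | a)`, where `y a` is
the true label of `a`. The steps `s` given to the generator are finite sequences of tokens. -/
def expectedReward (r : Label → Label → ℝ) (y : GenAction V ℓ → Label) (p : PMF (List V))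
    (π : List V → Policy (GenAction V ℓ)) (ρ : GenAction V ℓ → Policy Label) : ℝ :=
  ∑' s, (p s).toReal * ∑ a, (π s).1 a * ∑ y', (ρ a).1 y' * r (y a) y'

/-- The generator's regularized utility, for strategies that are elements of `Δ(A_G)` and
`Δ(A_R)`. -/
def utilityG (y : GenAction V ℓ → Label) (p : PMF (List V)) (τ cH : ℝ)
    (π₀ : Policy (GenAction V ℓ)) (π : Policy (GenAction V ℓ)) (ρ : Policy Label) : EReal :=
  ((expectedReward rewardG y p (fun _ => π) (fun _ => ρ) + cH * entropy π : ℝ) : EReal)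
    - (τ : EReal) * (kl π π₀ : EReal)

/-- The reward model's regularized utility, for strategies that are elements of `Δ(A_G)` and
`Δ(A_R)`. -/
def utilityR (y : GenAction V ℓ → Label) (p : PMF (List V)) (τ cH : ℝ)
    (ρ₀ : Policy Label) (π : Policy (GenAction V ℓ)) (ρ : Policy Label) : EReal :=
  ((expectedReward rewardR y p (fun _ => π) (fun _ => ρ) + cH * entropy ρ : ℝ) : EReal)
    - (τ : EReal) * (kl ρ ρ₀ : EReal)

/-- The generator's regularized utility when policies are conditional on what the players observe:
divergence and entropy of `π(· | s)` are averaged over `s ∼ p`. -/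
def condUtilityG (y : GenAction V ℓ → Label) (p : PMF (List V)) (τ cH : ℝ)
    (π₀ : List V → Policy (GenAction V ℓ)) (π : List V → Policy (GenAction V ℓ))
    (ρ : GenAction V ℓ → Policy Label) : EReal :=
  ((expectedReward rewardG y p π ρ
      + cH * ∑' s, (p s).toReal * entropy (π s) : ℝ) : EReal)
    - (τ : EReal) * ((∑' s, p s * kl (π s) (π₀ s) : ENNReal) : EReal)

/-- The reward model's regularized utility when policies are conditional on what the players
observe: divergence and entropy of `ρ(· | a)` are averaged over `s ∼ p`, `a ∼ π(· | s)`. -/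
def condUtilityR (y : GenAction V ℓ → Label) (p : PMF (List V)) (τ cH : ℝ)
    (ρ₀ : GenAction V ℓ → Policy Label) (π : List V → Policy (GenAction V ℓ))
    (ρ : GenAction V ℓ → Policy Label) : EReal :=
  ((expectedReward rewardR y p π ρ
      + cH * ∑' s, (p s).toReal * ∑ a, (π s).1 a * entropy (ρ a) : ℝ) : EReal)
    - (τ : EReal) *
      ((∑' s, p s * ∑ a, ENNReal.ofReal ((π s).1 a) * kl (ρ a) (ρ₀ a) : ENNReal) : EReal)

end Game

end AdversarialPRM

end

/-! Against a fixed opponent, a player's utility is linear in the own distribution `x`, plus `cH`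
times entropy, minus `τ` times the divergence from the reference. Completing the logarithm turns
this into a constant minus `(τ + cH)` times the divergence of `x` from a Gibbs distribution
(`payoff_sub_eq`), so that distribution is a best response, continuous in the payoffs. For
unconditional strategies, composing the two best responses gives a continuous self-map of the
segment `Δ({0,1})`; the intermediate value theorem supplies a fixed point, which is an equilibrium.
For conditional strategies no fixed point is needed: the reward model can optimize at each `a`
regardless of the generator, which then responds at each `s`. Pointwise optimality survives
averaging by `tsum_sub_mul_tsum_le`. -/

noncomputable section

namespace AdversarialPRM

/-! ### Gibbs distributions as best responses -/

section Gibbs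

variable {A : Type*} [Fintype A]

/-- Unnormalized Gibbs weights of the payoff `c` relative to `x₀`. -/
def gibbsWeight (τ cH : ℝ) (x₀ : Policy A) (c : A → ℝ) (a : A) : ℝ :=
  if x₀.1 a = 0 then 0 else Real.exp ((c a + τ * Real.log (x₀.1 a)) / (τ + cH))

theorem gibbsWeight_nonneg (τ cH : ℝ) (x₀ : Policy A) (c : A → ℝ) (a : A) :
    0 ≤ gibbsWeight τ cH x₀ c a := by
  unfold gibbsWeight
  split_ifs
  · exact le_rfl
  · exact (Real.exp_pos _).le

theorem gibbsWeight_eq_zero_iff (τ cH : ℝ) (x₀ : Policy A) (c : A → ℝ) (a : A) :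
    gibbsWeight τ cH x₀ c a = 0 ↔ x₀.1 a = 0 := by
  unfold gibbsWeight
  split_ifs with h <;> simp [h, Real.exp_ne_zero]

theorem sum_gibbsWeight_pos (τ cH : ℝ) (x₀ : Policy A) (c : A → ℝ) :
    0 < ∑ a, gibbsWeight τ cH x₀ c a := by
  refine lt_of_le_of_ne (Finset.sum_nonneg fun a _ => gibbsWeight_nonneg τ cH x₀ c a) fun h => ?_
  have h0 := (Finset.sum_eq_zero_iff_of_nonneg
    fun a _ => gibbsWeight_nonneg τ cH x₀ c a).1 h.symm
  have h1 : ∑ a, x₀.1 a = 0 :=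
    Finset.sum_eq_zero fun a ha => (gibbsWeight_eq_zero_iff τ cH x₀ c a).1 (h0 a ha)
  exact zero_ne_one (h1.symm.trans x₀.2.2)

/-- The Gibbs distribution of the payoff `c` relative to `x₀`. -/
def gibbs (τ cH : ℝ) (x₀ : Policy A) (c : A → ℝ) : Policy A :=
  ⟨fun a => gibbsWeight τ cH x₀ c a / ∑ b, gibbsWeight τ cH x₀ c b,
    fun a => div_nonneg (gibbsWeight_nonneg τ cH x₀ c a) (sum_gibbsWeight_pos τ cH x₀ c).le,
    by rw [← Finset.sum_div, div_self (sum_gibbsWeight_pos τ cH x₀ c).ne']⟩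

/-- The case split in `gibbsWeight` overrides the default `Real.log 0 = 0`; equal supports keep the
divergences in both directions finite. -/
theorem gibbs_eq_zero_iff (τ cH : ℝ) (x₀ : Policy A) (c : A → ℝ) (a : A) :
    (gibbs τ cH x₀ c).1 a = 0 ↔ x₀.1 a = 0 := by
  simp [gibbs, (sum_gibbsWeight_pos τ cH x₀ c).ne', gibbsWeight_eq_zero_iff]

theorem continuous_gibbs (τ cH : ℝ) (x₀ : Policy A) : Continuous (gibbs τ cH x₀) := by
  have h : ∀ a, Continuous fun c => gibbsWeight τ cH x₀ c a := by
    intro a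
    unfold gibbsWeight
    split_ifs <;> fun_prop
  refine Continuous.subtype_mk (continuous_pi fun a => ?_) _
  exact (h a).div (continuous_finsetSum _ fun b _ => h b)
    fun c => (sum_gibbsWeight_pos τ cH x₀ c).ne'

/-- Expected payoff of `x` for the payoff vector `c`, with an entropy bonus. -/
def payoff (cH : ℝ) (c : A → ℝ) (x : Policy A) : ℝ := ∑ a, x.1 a * c a + cH * entropy x

theorem continuous_payoff (cH : ℝ) (c : A → ℝ) : Continuous (payoff cH c) := by
  have h : ∀ a, Continuous fun x : Policy A => x.1 a := fun a =>
    (continuous_apply a).comp continuous_subtype_val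
  have h' : Continuous (entropy (A := A)) :=
    (continuous_finsetSum _ fun a _ => Real.continuous_mul_log.comp (h a)).neg
  exact (continuous_finsetSum _ fun a _ => (h a).mul continuous_const).add
    (continuous_const.mul h')

/-- Compactness of the simplex; the uniform bound makes the series over `s ∼ p` converge. -/
theorem exists_abs_payoff_le (cH : ℝ) (c : A → ℝ) : ∃ C, ∀ x : Policy A, |payoff cH c x| ≤ C := by
  obtain ⟨C, hC⟩ := (isCompact_univ (X := Policy A)).exists_bound_of_continuousOn
    (continuous_payoff cH c).continuousOn
  exact ⟨C, fun x => hC x (Set.mem_univ x)⟩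

/-- On distributions supported where `x₀` is, the regularized payoff is a constant minus a
multiple of the divergence from the Gibbs distribution. -/
theorem payoff_sub_eq {τ cH : ℝ} (hτ : 0 < τ) (hcH : 0 < cH) (x₀ : Policy A) (c : A → ℝ)
    (x : Policy A) (hx : ∀ a, x₀.1 a = 0 → x.1 a = 0) :
    payoff cH c x - τ * ∑ a, x.1 a * Real.log (x.1 a / x₀.1 a) =
      (τ + cH) * Real.log (∑ a, gibbsWeight τ cH x₀ c a) -
        (τ + cH) * ∑ a, x.1 a * Real.log (x.1 a / (gibbs τ cH x₀ c).1 a) := by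
  set Z := ∑ a, gibbsWeight τ cH x₀ c a with hZ
  have hZ0 : 0 < Z := sum_gibbsWeight_pos τ cH x₀ c
  have hl : τ + cH ≠ 0 := (add_pos hτ hcH).ne'
  -- Spreading the constant over the total mass 1 of `x` lets the identity be checked action by
  -- action.
  have h1 : (τ + cH) * Real.log Z = ∑ a, x.1 a * ((τ + cH) * Real.log Z) := by
    rw [← Finset.sum_mul, x.2.2, one_mul]
  rw [h1, payoff, entropy, mul_neg, Finset.mul_sum, Finset.mul_sum, Finset.mul_sum,
    ← sub_eq_add_neg, ← Finset.sum_sub_distrib, ← Finset.sum_sub_distrib,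
    ← Finset.sum_sub_distrib]
  refine Finset.sum_congr rfl fun a _ => ?_
  by_cases ha : x.1 a = 0
  · simp [ha]
  · have h0 : x₀.1 a ≠ 0 := fun h => ha (hx a h)
    have hg : (gibbs τ cH x₀ c).1 a =
        Real.exp ((c a + τ * Real.log (x₀.1 a)) / (τ + cH)) / Z := by
      simp [gibbs, gibbsWeight, h0, hZ]
    rw [hg, Real.log_div ha h0, Real.log_div ha (div_pos (Real.exp_pos _) hZ0).ne',
      Real.log_div (Real.exp_pos _).ne' hZ0.ne', Real.log_exp]
    field_simp
    ring

theorem coe_kl_of_support {x x₀ : Policy A} (hx : ∀ a, x₀.1 a = 0 → x.1 a = 0) :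
    (kl x x₀ : EReal) = ((∑ a, x.1 a * Real.log (x.1 a / x₀.1 a) : ℝ) : EReal) := by
  rw [kl, if_pos hx, EReal.coe_ennreal_ofReal, max_eq_left (kl_sum_nonneg x x₀ hx)]

/-- The Gibbs distribution maximizes the regularized payoff. -/
theorem payoff_sub_kl_le_gibbs {τ cH : ℝ} (hτ : 0 < τ) (hcH : 0 < cH) (x₀ : Policy A)
    (c : A → ℝ) (x : Policy A) :
    (payoff cH c x : EReal) - (τ : EReal) * (kl x x₀ : EReal) ≤
      (payoff cH c (gibbs τ cH x₀ c) : EReal)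
        - (τ : EReal) * (kl (gibbs τ cH x₀ c) x₀ : EReal) := by
  by_cases hx : ∀ a, x₀.1 a = 0 → x.1 a = 0
  · have hg : ∀ a, x₀.1 a = 0 → (gibbs τ cH x₀ c).1 a = 0 := fun a =>
      (gibbs_eq_zero_iff τ cH x₀ c a).2
    rw [coe_kl_of_support hx, coe_kl_of_support hg]
    norm_cast
    rw [payoff_sub_eq hτ hcH x₀ c x hx, payoff_sub_eq hτ hcH x₀ c _ hg]
    have h1 := kl_sum_nonneg x (gibbs τ cH x₀ c) fun a h =>
      hx a ((gibbs_eq_zero_iff τ cH x₀ c a).1 h)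
    have h2 : ∑ a, (gibbs τ cH x₀ c).1 a *
        Real.log ((gibbs τ cH x₀ c).1 a / (gibbs τ cH x₀ c).1 a) = 0 := by
      refine Finset.sum_eq_zero fun a _ => ?_
      by_cases h : (gibbs τ cH x₀ c).1 a = 0
      · simp [h]
      · simp [div_self h]
    rw [h2, mul_zero, sub_zero]
    exact sub_le_self _ (mul_nonneg (add_pos hτ hcH).le h1)
  -- Charging a point outside the support of `x₀` costs `-∞`.
  · rw [kl, if_neg hx, EReal.coe_ennreal_top, EReal.coe_mul_top_of_pos hτ, EReal.sub_top]
    exact bot_le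

end Gibbs

/-- Pointwise comparisons of penalized payoffs pass to weighted sums. -/
theorem tsum_sub_mul_tsum_le {ι : Type*} {w : ι → ENNReal} (hw : ∑' i, w i ≠ ⊤) {f g : ι → ℝ}
    {C D : ℝ} (hf : ∀ i, |f i| ≤ C) (hg : ∀ i, |g i| ≤ D) {k l : ι → ENNReal} {τ : ℝ}
    (hτ : 0 < τ)
    (h : ∀ i, (f i : EReal) - (τ : EReal) * (k i : EReal) ≤
      (g i : EReal) - (τ : EReal) * (l i : EReal)) :
    ((∑' i, (w i).toReal * f i : ℝ) : EReal)
        - (τ : EReal) * ((∑' i, w i * k i : ENNReal) : EReal) ≤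
      ((∑' i, (w i).toReal * g i : ℝ) : EReal)
        - (τ : EReal) * ((∑' i, w i * l i : ENNReal) : EReal) := by
  by_cases hk : ∑' i, w i * k i = ⊤
  · rw [hk, EReal.coe_ennreal_top, EReal.coe_mul_top_of_pos hτ, EReal.sub_top]
    exact bot_le
  -- If `k i` is finite, the left side of `h i` is real, so `l i = ⊤` would put a real number below
  -- `-∞`.
  have hreal : ∀ i, k i ≠ ⊤ → l i ≠ ⊤ ∧
      f i - τ * (k i).toReal ≤ g i - τ * (l i).toReal := by
    intro i hi
    have hi' := h i
    lift k i to NNReal using hi with ki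
    by_cases hl : l i = ⊤
    · rw [hl, EReal.coe_ennreal_top, EReal.coe_mul_top_of_pos hτ, EReal.sub_top, le_bot_iff] at hi'
      exact absurd hi' (by exact_mod_cast EReal.coe_ne_bot (f i - τ * ki))
    · lift l i to NNReal using hl with li
      refine ⟨ENNReal.coe_ne_top, ?_⟩
      rw [EReal.coe_nnreal_eq_coe_real, EReal.coe_nnreal_eq_coe_real] at hi'
      simp only [ENNReal.coe_toReal]
      exact_mod_cast hi'
  have hwk : ∀ i, w i * k i ≠ ⊤ := ENNReal.ne_top_of_tsum_ne_top hk
  have hwi : ∀ i, w i ≠ ⊤ := ENNReal.ne_top_of_tsum_ne_top hw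
  have hki : ∀ i, w i ≠ 0 → k i ≠ ⊤ := fun i h0 ht => hwk i (by rw [ht, ENNReal.mul_top h0])
  -- From `τ * l ≤ τ * k + g - f ≤ τ * k + D + C`, divided by `τ`. Summed, this bounds the
  -- divergence series on the right. Indices with `w i = 0` may have `k i = ⊤`, but `0 * ⊤ = 0`.
  have hle : ∀ i, w i * l i ≤ w i * k i + w i * ENNReal.ofReal ((C + D) / τ) := by
    intro i
    by_cases h0 : w i = 0
    · simp [h0]
    rw [← mul_add]
    gcongr
    obtain ⟨hl, hr⟩ := hreal i (hki i h0)
    have hC := abs_le.1 (hf i)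
    have hD := abs_le.1 (hg i)
    rw [← ENNReal.ofReal_toReal hl, ← ENNReal.ofReal_toReal (hki i h0),
      ← ENNReal.ofReal_add ENNReal.toReal_nonneg (div_nonneg (by linarith) hτ.le)]
    refine ENNReal.ofReal_le_ofReal ?_
    rw [← sub_le_iff_le_add', le_div_iff₀ hτ]
    linarith
  have hl : ∑' i, w i * l i ≠ ⊤ := by
    refine ne_top_of_le_ne_top ?_ (ENNReal.tsum_le_tsum hle)
    rw [ENNReal.tsum_add, ENNReal.tsum_mul_right]
    exact ENNReal.add_ne_top.2 ⟨hk, ENNReal.mul_ne_top hw ENNReal.ofReal_ne_top⟩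
  have hwl := ENNReal.ne_top_of_tsum_ne_top hl
  have hsum : ∀ {u : ι → ℝ} {B : ℝ}, (∀ i, |u i| ≤ B) →
      Summable fun i => (w i).toReal * u i := fun {u B} hu =>
    Summable.of_norm_bounded ((ENNReal.summable_toReal hw).mul_right B) fun i => by
      rw [norm_mul, Real.norm_of_nonneg ENNReal.toReal_nonneg]
      exact mul_le_mul_of_nonneg_left (hu i) ENNReal.toReal_nonneg
  have hK := (ENNReal.summable_toReal hk).mul_left τ
  have hL := (ENNReal.summable_toReal hl).mul_left τ
  rw [← ENNReal.ofReal_toReal hk, ← ENNReal.ofReal_toReal hl, EReal.coe_ennreal_ofReal,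
    EReal.coe_ennreal_ofReal, max_eq_left ENNReal.toReal_nonneg,
    max_eq_left ENNReal.toReal_nonneg, ENNReal.tsum_toReal_eq hwk, ENNReal.tsum_toReal_eq hwl]
  norm_cast
  rw [← tsum_mul_left, ← tsum_mul_left, ← (hsum hf).tsum_sub hK, ← (hsum hg).tsum_sub hL]
  refine ((hsum hf).sub hK).tsum_le_tsum (fun i => ?_) ((hsum hg).sub hL)
  by_cases h0 : w i = 0
  · simp [h0]
  · have := mul_le_mul_of_nonneg_left (hreal i (hki i h0)).2 (ENNReal.toReal_nonneg (a := w i))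
    simp only [ENNReal.toReal_mul]
    linarith

theorem summable_toReal_mul {ι : Type*} (p : PMF ι) {u : ι → ℝ} {B : ℝ} (hu : ∀ i, |u i| ≤ B) :
    Summable fun i => (p i).toReal * u i :=
  Summable.of_norm_bounded ((ENNReal.summable_toReal p.tsum_coe_ne_top).mul_right B) fun i => by
    rw [norm_mul, Real.norm_of_nonneg ENNReal.toReal_nonneg]
    exact mul_le_mul_of_nonneg_left (hu i) ENNReal.toReal_nonneg

theorem abs_sum_mul_le {A : Type*} [Fintype A] (c : A → ℝ) (x : Policy A) :
    |∑ a, x.1 a * c a| ≤ ∑ a, |c a| := by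
  refine (Finset.abs_sum_le_sum_abs _ _).trans (Finset.sum_le_sum fun a _ => ?_)
  have h1 : x.1 a ≤ 1 := x.2.2 ▸ Finset.single_le_sum (fun b _ => x.2.1 b) (Finset.mem_univ a)
  rw [abs_mul, abs_of_nonneg (x.2.1 a)]
  exact mul_le_of_le_one_left (abs_nonneg _) h1

theorem exists_abs_entropy_le (A : Type*) [Fintype A] : ∃ C, ∀ x : Policy A, |entropy x| ≤ C := by
  obtain ⟨C, hC⟩ := exists_abs_payoff_le (A := A) 1 0
  exact ⟨C, fun x => by simpa [payoff] using hC x⟩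

/-- A continuous self-map of the simplex on two points has a fixed point. -/
theorem exists_fixedPoint_policy_label (F : Policy Label → Policy Label) (hF : Continuous F) :
    ∃ x, F x = x := by
  let e := stdSimplexHomeomorphUnitInterval
  let G : unitInterval → unitInterval := fun t => e (F (e.symm t))
  have hG : Continuous G := by fun_prop
  obtain ⟨t, ht⟩ : ∃ t : unitInterval, G t = t := by
    -- The identity lies below `G` at `0` and above it at `1`.
    obtain ⟨t, -, ht⟩ := isPreconnected_univ.intermediate_value₂ (Set.mem_univ (0 : unitInterval))
      (Set.mem_univ 1) continuous_id.continuousOn hG.continuousOn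
      unitInterval.nonneg' unitInterval.le_one'
    exact ⟨t, ht.symm⟩
  exact ⟨e.symm t, e.toEquiv.eq_symm_apply.2 ht⟩

/-! ### Equilibria of the two games -/

section Game

variable {V : Type*} [Fintype V] {ℓ : ℕ}

/-- Expected reward `r` of each action of the generator against `ρ`. -/
def generatorPayoff (r : Label → Label → ℝ) (y : GenAction V ℓ → Label)
    (ρ : GenAction V ℓ → Policy Label) (a : GenAction V ℓ) : ℝ :=
  ∑ y', (ρ a).1 y' * r (y a) y'

/-- Expected reward `r` of each label predicted by the reward model against `π`. -/
def labelPayoff (r : Label → Label → ℝ) (y : GenAction V ℓ → Label)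
    (π : Policy (GenAction V ℓ)) (y' : Label) : ℝ :=
  ∑ a, π.1 a * r (y a) y'

theorem expectedReward_const (r : Label → Label → ℝ) (y : GenAction V ℓ → Label)
    (p : PMF (List V)) (π : Policy (GenAction V ℓ)) (ρ : GenAction V ℓ → Policy Label) :
    expectedReward r y p (fun _ => π) ρ = ∑ a, π.1 a * generatorPayoff r y ρ a := by
  rw [expectedReward, tsum_mul_right, ← ENNReal.tsum_toReal_eq p.apply_ne_top, p.tsum_coe,
    ENNReal.toReal_one, one_mul]
  rfl

/-- The expected reward is bilinear, so it is also a linear payoff for the reward model. -/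
theorem sum_mul_labelPayoff (r : Label → Label → ℝ) (y : GenAction V ℓ → Label)
    (π : Policy (GenAction V ℓ)) (ρ : Policy Label) :
    ∑ y', ρ.1 y' * labelPayoff r y π y' =
      ∑ a, π.1 a * generatorPayoff r y (fun _ => ρ) a := by
  simp only [labelPayoff, generatorPayoff, Finset.mul_sum]
  rw [Finset.sum_comm]
  exact Finset.sum_congr rfl fun a _ => Finset.sum_congr rfl fun b _ => by ring

theorem utilityG_eq (y : GenAction V ℓ → Label) (p : PMF (List V)) (τ cH : ℝ)
    (π₀ π : Policy (GenAction V ℓ)) (ρ : Policy Label) :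
    utilityG y p τ cH π₀ π ρ =
      (payoff cH (generatorPayoff rewardG y fun _ => ρ) π : EReal)
        - (τ : EReal) * (kl π π₀ : EReal) := by
  rw [utilityG, expectedReward_const, payoff]

theorem utilityR_eq (y : GenAction V ℓ → Label) (p : PMF (List V)) (τ cH : ℝ)
    (ρ₀ : Policy Label) (π : Policy (GenAction V ℓ)) (ρ : Policy Label) :
    utilityR y p τ cH ρ₀ π ρ =
      (payoff cH (labelPayoff rewardR y π) ρ : EReal) - (τ : EReal) * (kl ρ ρ₀ : EReal) := by
  rw [utilityR, expectedReward_const, payoff, sum_mul_labelPayoff]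

theorem exists_isNash (y : GenAction V ℓ → Label) (p : PMF (List V)) {τ cH : ℝ} (hτ : 0 < τ)
    (hcH : 0 < cH) (π₀ : Policy (GenAction V ℓ)) (ρ₀ : Policy Label) :
    ∃ (π : Policy (GenAction V ℓ)) (ρ : Policy Label),
      IsNash (utilityG y p τ cH π₀) (utilityR y p τ cH ρ₀) π ρ := by
  let bestG : Policy Label → Policy (GenAction V ℓ) := fun ρ =>
    gibbs τ cH π₀ (generatorPayoff rewardG y fun _ => ρ)
  let bestR : Policy (GenAction V ℓ) → Policy Label := fun π =>
    gibbs τ cH ρ₀ (labelPayoff rewardR y π)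
  have hcG : Continuous bestG := (continuous_gibbs τ cH π₀).comp <| continuous_pi fun a =>
    continuous_finsetSum _ fun b _ =>
      ((continuous_apply b).comp continuous_subtype_val).mul continuous_const
  have hcR : Continuous bestR := (continuous_gibbs τ cH ρ₀).comp <| continuous_pi fun b =>
    continuous_finsetSum _ fun a _ =>
      ((continuous_apply a).comp continuous_subtype_val).mul continuous_const
  -- The fixed point is sought on the reward model's side, where the simplex is one-dimensional.
  obtain ⟨ρ, hρ⟩ := exists_fixedPoint_policy_label (bestR ∘ bestG) (hcR.comp hcG)
  refine ⟨bestG ρ, ρ, fun π' => ?_, fun ρ' => ?_⟩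
  · rw [utilityG_eq, utilityG_eq]
    exact payoff_sub_kl_le_gibbs hτ hcH π₀ _ π'
  · have h := payoff_sub_kl_le_gibbs hτ hcH ρ₀ (labelPayoff rewardR y (bestG ρ)) ρ'
    rw [utilityR_eq, utilityR_eq]
    rwa [show gibbs τ cH ρ₀ (labelPayoff rewardR y (bestG ρ)) = ρ from hρ] at h

/-- Merging the reward and entropy series requires both to be summable, hence the uniform bounds. -/
theorem condUtilityG_eq (y : GenAction V ℓ → Label) (p : PMF (List V)) (τ cH : ℝ)
    (π₀ π : List V → Policy (GenAction V ℓ)) (ρ : GenAction V ℓ → Policy Label) :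
    condUtilityG y p τ cH π₀ π ρ =
      ((∑' s, (p s).toReal * payoff cH (generatorPayoff rewardG y ρ) (π s) : ℝ) : EReal)
        - (τ : EReal) * ((∑' s, p s * kl (π s) (π₀ s) : ENNReal) : EReal) := by
  obtain ⟨C, hC⟩ := exists_abs_entropy_le (GenAction V ℓ)
  have h1 : Summable fun s => (p s).toReal *
      ∑ a, (π s).1 a * ∑ y', (ρ a).1 y' * rewardG (y a) y' :=
    summable_toReal_mul p fun s => abs_sum_mul_le (generatorPayoff rewardG y ρ) (π s)
  have h2 : Summable fun s => cH * ((p s).toReal * entropy (π s)) :=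
    (summable_toReal_mul p fun s => hC (π s)).mul_left cH
  rw [condUtilityG, expectedReward, ← tsum_mul_left, ← h1.tsum_add h2]
  congr 2
  refine tsum_congr fun s => ?_
  rw [payoff, mul_add, mul_left_comm cH]
  rfl

theorem condUtilityR_eq (y : GenAction V ℓ → Label) (p : PMF (List V)) (τ cH : ℝ)
    (ρ₀ : GenAction V ℓ → Policy Label) (π : List V → Policy (GenAction V ℓ))
    (ρ : GenAction V ℓ → Policy Label) :
    condUtilityR y p τ cH ρ₀ π ρ =
      ((∑' s, (p s).toReal * ∑ a, (π s).1 a * payoff cH (rewardR (y a)) (ρ a) : ℝ) : EReal)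
        - (τ : EReal) *
          ((∑' s, p s * ∑ a, ENNReal.ofReal ((π s).1 a) * kl (ρ a) (ρ₀ a) : ENNReal) :
            EReal) := by
  have h1 : Summable fun s => (p s).toReal *
      ∑ a, (π s).1 a * ∑ y', (ρ a).1 y' * rewardR (y a) y' :=
    summable_toReal_mul p fun s => abs_sum_mul_le (generatorPayoff rewardR y ρ) (π s)
  have h2 : Summable fun s => cH * ((p s).toReal * ∑ a, (π s).1 a * entropy (ρ a)) :=
    (summable_toReal_mul p fun s => abs_sum_mul_le (fun a => entropy (ρ a)) (π s)).mul_left cH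
  rw [condUtilityR, expectedReward, ← tsum_mul_left, ← h1.tsum_add h2]
  congr 2
  refine tsum_congr fun s => ?_
  simp only [payoff, mul_add, Finset.sum_add_distrib, Finset.mul_sum]
  congr 1
  exact Finset.sum_congr rfl fun a _ => by ring

/-- With conditional policies, the best response of the reward model does not depend on the
generator's policy. -/
theorem exists_isNash_cond (y : GenAction V ℓ → Label) (p : PMF (List V)) {τ cH : ℝ}
    (hτ : 0 < τ) (hcH : 0 < cH) (π₀ : List V → Policy (GenAction V ℓ))
    (ρ₀ : GenAction V ℓ → Policy Label) :
    ∃ (π : List V → Policy (GenAction V ℓ)) (ρ : GenAction V ℓ → Policy Label),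
      IsNash (condUtilityG y p τ cH π₀) (condUtilityR y p τ cH ρ₀) π ρ := by
  -- Reward, entropy and divergence at `a` all carry the same nonnegative weight, so maximizing at
  -- each `a` is optimal against every `π`.
  let ρ : GenAction V ℓ → Policy Label := fun a => gibbs τ cH (ρ₀ a) (rewardR (y a))
  let π : List V → Policy (GenAction V ℓ) := fun s =>
    gibbs τ cH (π₀ s) (generatorPayoff rewardG y ρ)
  refine ⟨π, ρ, fun π' => ?_, fun ρ' => ?_⟩
  · rw [condUtilityG_eq, condUtilityG_eq]
    obtain ⟨C, hC⟩ := exists_abs_payoff_le cH (generatorPayoff rewardG y ρ)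
    exact tsum_sub_mul_tsum_le p.tsum_coe_ne_top (fun s => hC _) (fun s => hC _) hτ
      fun s => payoff_sub_kl_le_gibbs hτ hcH (π₀ s) _ (π' s)
  · rw [condUtilityR_eq, condUtilityR_eq]
    refine tsum_sub_mul_tsum_le p.tsum_coe_ne_top
      (fun s => abs_sum_mul_le (fun a => payoff cH (rewardR (y a)) (ρ' a)) (π s))
      (fun s => abs_sum_mul_le (fun a => payoff cH (rewardR (y a)) (ρ a)) (π s)) hτ fun s => ?_
    have hbd : ∀ (σ : GenAction V ℓ → Policy Label) (a : GenAction V ℓ),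
        |payoff cH (rewardR (y a)) (σ a)| ≤ ∑ b, |payoff cH (rewardR (y b)) (σ b)| :=
      fun σ a => Finset.single_le_sum (f := fun b => |payoff cH (rewardR (y b)) (σ b)|)
        (fun b _ => abs_nonneg _) (Finset.mem_univ a)
    have hw : ∑' a, ENNReal.ofReal ((π s).1 a) ≠ ⊤ := by
      rw [tsum_fintype]
      exact ENNReal.sum_ne_top.2 fun a _ => ENNReal.ofReal_ne_top
    -- The averaging lemma applies a second time, now over `a` with weights `π(a|s)`.
    have h := tsum_sub_mul_tsum_le hw (hbd ρ') (hbd ρ) hτ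
      fun a => payoff_sub_kl_le_gibbs hτ hcH (ρ₀ a) (rewardR (y a)) (ρ' a)
    simpa only [tsum_fintype, ENNReal.toReal_ofReal ((π s).2.1 _)] using h

end Game

end AdversarialPRM

end

theorem theorem1 {V : Type*} [Fintype V] (ℓ : ℕ)
    (y : AdversarialPRM.GenAction V ℓ → AdversarialPRM.Label) (p : PMF (List V))
    (τ cH : ℝ) (hτ : 0 < τ) (hcH : 0 < cH) :
    (∀ (π₀ : AdversarialPRM.Policy (AdversarialPRM.GenAction V ℓ))
        (ρ₀ : AdversarialPRM.Policy AdversarialPRM.Label),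
      ∃ (π : AdversarialPRM.Policy (AdversarialPRM.GenAction V ℓ))
        (ρ : AdversarialPRM.Policy AdversarialPRM.Label),
        AdversarialPRM.IsNash (AdversarialPRM.utilityG y p τ cH π₀)
          (AdversarialPRM.utilityR y p τ cH ρ₀) π ρ) ∧
    (∀ (π₀ : List V → AdversarialPRM.Policy (AdversarialPRM.GenAction V ℓ))
        (ρ₀ : AdversarialPRM.GenAction V ℓ → AdversarialPRM.Policy AdversarialPRM.Label),
      ∃ (π : List V → AdversarialPRM.Policy (AdversarialPRM.GenAction V ℓ))
        (ρ : AdversarialPRM.GenAction V ℓ → AdversarialPRM.Policy AdversarialPRM.Label),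
        AdversarialPRM.IsNash (AdversarialPRM.condUtilityG y p τ cH π₀)
          (AdversarialPRM.condUtilityR y p τ cH ρ₀) π ρ) := by
  exact ⟨AdversarialPRM.exists_isNash y p hτ hcH, AdversarialPRM.exists_isNash_cond y p hτ hcH⟩
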